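/- Let $S$ be a semitopological semigroup (a semigroup with a Hausdorff topology and separately continuous multiplication) that is right reversible: $\overline{Sa}\cap\overline{Sb}\neq\emptyset$ for all $a,b\in S$. Let $C$ be a nonempty norm-closed subset of a complex Hilbert space $H$, and let $\mathcal S=\{T_s:s\in S\}$ be a representation of $S$ on $C$, i.e. $T_s:C\to C$ and $T_{st}=T_sT_t$, such that $s\mapsto T_sx$ is norm continuous for each $x\in C$. Suppose that $S$ is generated by a subset $\Lambda$ such that for each $s\in\Lambda$ the map $T=T_s$ is generalized hybrid: there are $\alpha,\beta\in\mathbb R$ with $$\alpha\|Tx-Ty\|^2+(1-\alpha)\|x-Ty\|^2\le\beta\|Tx-y\|^2+(1-\beta)\|x-y\|^2\qquad(x,y\in C).$$ Suppose that the orbit $\{T_sc:s\in S\}$ is bounded for some $c\in C$. For $f\in C_b(S)$ (bounded continuous complex functions, supremum norm) let $(\ell_sf)(t)=f(st)$ and $(r_sf)(t)=f(ts)$. Let $LUC(S)$, $AP(S)$, $WAP(S)$ be the sets of $f\in C_b(S)$ for which, respectively, $s\mapsto\ell_sf$ is norm continuous, $\{\ell_sf:s\in S\}$ is relatively norm compact,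 $\{\ell_sf:s\in S\}$ is relatively weakly compact in $C_b(S)$. Assume one of the following: 1. $X=C_b(S)$; 2. $X=LUC(S)$, and $(s,x)\mapsto T_sx$ is jointly continuous from $S\times C$ to $C$, where $C$ carries the weak topology of $H$; 3. $X=AP(S)$, and the family $\{T_s:s\in S\}$ of self-maps of $C$ is equicontinuous (at each point of $C$) for the weak uniformity of $H$ on $C$; 4. $X=WAP(S)$, and for each $x\in C$ with a bounded orbit the action is weakly quasi-equicontinuous on the weak closure $K_x$ of $\{T_sx:s\in S\}$ in $C$: every map $K_x\to C$ that is a limit, pointwise in the weak topology, of a net of the maps $T_s|_{K_x}$ is weakly continuous; and in cases 2–4 assume moreover that every bounded orbit $\{T_sx:s\in S\}$, $x\in C$, is relatively weakly compact in $C$ (which is automatic if $C$ is weakly closed, in particular if $C$ is convex). Let $\mu$ be a two-sided invariant mean on $X$: a linear functional with $\|\mu\|=\mu(1)=1$ and $\mu(\ell_sf)=\mu(f)=\mu(r_sf)$ for $f\in X$, $s\in S$. Then: * the set $A_C(\mathcal S)=\{a\in H:\|a-T_sx\|\le\|a-x\|\text{ for all }s\in S,\ x\in C\}$ is nonempty,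 closed and convex; * for every $x\in C$ and $y\in H$ the function $s\mapsto\langle T_sx\,|\,y\rangle$ belongs to $X$, and there is a (unique) $T_\mu x\in H$ with $\langle T_\mu x\,|\,y\rangle=\mu\big(s\mapsto\langle T_sx\,|\,y\rangle\big)$ for all $y\in H$; moreover $T_\mu x\in A_C(\mathcal S)$ and $$\lim_tP_{A_C(\mathcal S)}(T_tx)=T_\mu x$$ in norm, where $P_{A_C(\mathcal S)}$ is the metric projection and the limit is taken as $t$ increases in the order of $S$ given by $a\le b\iff\overline{Sb}\cup\{b\}\subseteq\overline{Sa}\cup\{a\}$; * if in addition $C$ is convex, then there is $x\in C$ with $T_sx=x$ for all $s\in S$. -/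

import Mathlib

open Set Filter Topology
open scoped BoundedContinuousFunction

namespace HybridErgodic

noncomputable section

/-! ### Translations and invariant subspaces of bounded continuous functions -/

/-- The left translation `f ↦ ℓ_s f`, `(ℓ_s f)(t) = f (s t)`, on `C_b(S)`. -/
def leftTranslate {S : Type*} [Semigroup S] [TopologicalSpace S] [SeparatelyContinuousMul S]
    (s : S) : (S →ᵇ ℂ) →L[ℂ] (S →ᵇ ℂ) :=
  BoundedContinuousFunction.compContinuousCLM ℂ ℂ
    ⟨fun t => s * t, SeparatelyContinuousMul.continuous_const_mul⟩

/-- The right translation `f ↦ r_s f`, `(r_s f)(t) = f (t s)`, on `C_b(S)`. -/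
def rightTranslate {S : Type*} [Semigroup S] [TopologicalSpace S] [SeparatelyContinuousMul S]
    (s : S) : (S →ᵇ ℂ) →L[ℂ] (S →ᵇ ℂ) :=
  BoundedContinuousFunction.compContinuousCLM ℂ ℂ
    ⟨fun t => t * s, SeparatelyContinuousMul.continuous_mul_const⟩

@[simp]
theorem leftTranslate_apply {S : Type*} [Semigroup S] [TopologicalSpace S]
    [SeparatelyContinuousMul S] (s : S) (f : S →ᵇ ℂ) (t : S) :
    leftTranslate s f t = f (s * t) := rfl

@[simp]
theorem rightTranslate_apply {S : Type*} [Semigroup S] [TopologicalSpace S]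
    [SeparatelyContinuousMul S] (s : S) (f : S →ᵇ ℂ) (t : S) :
    rightTranslate s f t = f (t * s) := rfl

theorem leftTranslate_leftTranslate {S : Type*} [Semigroup S] [TopologicalSpace S]
    [SeparatelyContinuousMul S] (s t : S) (f : S →ᵇ ℂ) :
    leftTranslate s (leftTranslate t f) = leftTranslate (t * s) f := by
  ext r; simp [mul_assoc]

theorem leftTranslate_rightTranslate {S : Type*} [Semigroup S] [TopologicalSpace S]
    [SeparatelyContinuousMul S] (s t : S) (f : S →ᵇ ℂ) :
    leftTranslate s (rightTranslate t f) = rightTranslate t (leftTranslate s f) := by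
  ext r; simp [mul_assoc]

theorem leftTranslate_one {S : Type*} [Semigroup S] [TopologicalSpace S]
    [SeparatelyContinuousMul S] (s : S) : leftTranslate s (1 : S →ᵇ ℂ) = 1 := by
  ext r; simp

/-- A linear subspace of `C_b(S)` (with the supremum norm) that contains the constants and is
invariant under left and right translations. -/
structure InvariantSubspace (S : Type*) [Semigroup S] [TopologicalSpace S]
    [SeparatelyContinuousMul S] where
  toSubmodule : Submodule ℂ (S →ᵇ ℂ)
  one_mem : (1 : S →ᵇ ℂ) ∈ toSubmodule
  left_mem : ∀ (s : S) (f : S →ᵇ ℂ), f ∈ toSubmodule → leftTranslate s f ∈ toSubmodule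
  right_mem : ∀ (s : S) (f : S →ᵇ ℂ), f ∈ toSubmodule → rightTranslate s f ∈ toSubmodule

/-- `C_b(S)`: all bounded continuous functions. -/
def Cb (S : Type*) [Semigroup S] [TopologicalSpace S] [SeparatelyContinuousMul S] :
    InvariantSubspace S where
  toSubmodule := ⊤
  one_mem := trivial
  left_mem := fun _ _ _ => trivial
  right_mem := fun _ _ _ => trivial

/-- `LUC(S)`: those `f ∈ C_b(S)` for which `s ↦ ℓ_s f` is norm continuous. -/
def LUC (S : Type*) [Semigroup S] [TopologicalSpace S] [SeparatelyContinuousMul S] :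
    InvariantSubspace S where
  toSubmodule :=
    { carrier := {f | Continuous fun s : S => leftTranslate s f}
      zero_mem' := by simpa using continuous_const
      add_mem' := fun {f g} hf hg => by
        have h := Continuous.add (f := fun s : S => leftTranslate s f)
          (g := fun s : S => leftTranslate s g) hf hg
        change Continuous fun s : S => leftTranslate s (f + g)
        simpa [Pi.add_def] using h
      smul_mem' := fun c f hf => by
        have h := Continuous.const_smul (g := fun s : S => leftTranslate s f) hf c
        change Continuous fun s : S => leftTranslate s (c • f)
        simpa [Pi.smul_def] using h }
  one_mem := by
    change Continuous fun s : S => leftTranslate s (1 : S →ᵇ ℂ)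
    simpa [leftTranslate_one] using continuous_const
  left_mem := fun s f hf => by
    change Continuous fun t : S => leftTranslate t (leftTranslate s f)
    simp only [leftTranslate_leftTranslate]
    exact Continuous.comp (g := fun t : S => leftTranslate t f) hf SeparatelyContinuousMul.continuous_const_mul
  right_mem := fun s f hf => by
    change Continuous fun t : S => leftTranslate t (rightTranslate s f)
    simp only [leftTranslate_rightTranslate]
    exact (rightTranslate s).continuous.comp hf

/-- `AP(S)`: those `f ∈ C_b(S)` whose left orbit `{ℓ_s f : s ∈ S}` is relatively compact in norm. -/
def AP (S : Type*) [Semigroup S] [TopologicalSpace S] [SeparatelyContinuousMul S] :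
    InvariantSubspace S where
  toSubmodule :=
    { carrier := {f | IsCompact (closure (range fun s : S => leftTranslate s f))}
      zero_mem' := by
        refine IsCompact.closure_of_subset (isCompact_singleton (x := (0 : S →ᵇ ℂ))) ?_
        rintro _ ⟨s, rfl⟩; simp
      add_mem' := fun {f g} hf hg => by
        refine IsCompact.closure_of_subset (IsCompact.add hf hg) ?_
        rintro _ ⟨s, rfl⟩
        simp only [map_add]
        exact add_mem_add (subset_closure ⟨s, rfl⟩) (subset_closure ⟨s, rfl⟩)
      smul_mem' := fun c f hf => by
        refine IsCompact.closure_of_subset (hf.image (continuous_const_smul c)) ?_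
        rintro _ ⟨s, rfl⟩
        exact ⟨_, subset_closure ⟨s, rfl⟩, by simp⟩ }
  one_mem := by
    refine IsCompact.closure_of_subset (isCompact_singleton (x := (1 : S →ᵇ ℂ))) ?_
    rintro _ ⟨s, rfl⟩; simp [leftTranslate_one]
  left_mem := fun s f hf => by
    refine IsCompact.closure_of_subset hf ?_
    rintro _ ⟨t, rfl⟩
    exact subset_closure ⟨s * t, (leftTranslate_leftTranslate t s f).symm⟩
  right_mem := fun s f hf => by
    refine IsCompact.closure_of_subset (hf.image (rightTranslate s).continuous) ?_
    rintro _ ⟨t, rfl⟩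
    exact ⟨_, subset_closure ⟨t, rfl⟩, (leftTranslate_rightTranslate t s f).symm⟩

/-- `WAP(S)`: those `f ∈ C_b(S)` whose left orbit `{ℓ_s f : s ∈ S}` is relatively compact in the
weak topology of the Banach space `C_b(S)`. -/
def WAP (S : Type*) [Semigroup S] [TopologicalSpace S] [SeparatelyContinuousMul S] :
    InvariantSubspace S where
  toSubmodule :=
    { carrier := {f | IsCompact
        (closure (range fun s : S => toWeakSpace ℂ (S →ᵇ ℂ) (leftTranslate s f)))}
      zero_mem' := by
        refine IsCompact.closure_of_subset
          (isCompact_singleton (x := (0 : WeakSpace ℂ (S →ᵇ ℂ)))) ?_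
        rintro _ ⟨s, rfl⟩; simp
      add_mem' := fun {f g} hf hg => by
        refine IsCompact.closure_of_subset (IsCompact.add hf hg) ?_
        rintro _ ⟨s, rfl⟩
        simp only [map_add]
        exact add_mem_add (subset_closure ⟨s, rfl⟩) (subset_closure ⟨s, rfl⟩)
      smul_mem' := fun c f hf => by
        refine IsCompact.closure_of_subset (hf.image (continuous_const_smul c)) ?_
        rintro _ ⟨s, rfl⟩
        exact ⟨_, subset_closure ⟨s, rfl⟩, by simp⟩ }
  one_mem := by
    refine IsCompact.closure_of_subset
      (isCompact_singleton (x := toWeakSpace ℂ (S →ᵇ ℂ) 1)) ?_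
    rintro _ ⟨s, rfl⟩; simp [leftTranslate_one]
  left_mem := fun s f hf => by
    refine IsCompact.closure_of_subset hf ?_
    rintro _ ⟨t, rfl⟩
    exact subset_closure ⟨s * t, by simp [leftTranslate_leftTranslate]⟩
  right_mem := fun s f hf => by
    refine IsCompact.closure_of_subset
      (hf.image (WeakSpace.map (rightTranslate (S := S) s)).continuous) ?_
    rintro _ ⟨t, rfl⟩
    exact ⟨_, subset_closure ⟨t, rfl⟩,
      congrArg (toWeakSpace ℂ (S →ᵇ ℂ)) (leftTranslate_rightTranslate t s f).symm⟩

/-- A mean on `X` that is invariant under left and under right translations. -/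
structure IsInvariantMean {S : Type*} [Semigroup S] [TopologicalSpace S]
    [SeparatelyContinuousMul S] (X : InvariantSubspace S) (μ : X.toSubmodule →L[ℂ] ℂ) : Prop where
  norm_eq_one : ‖μ‖ = 1
  map_one : μ ⟨1, X.one_mem⟩ = 1
  map_left : ∀ (s : S) (f : X.toSubmodule), μ ⟨leftTranslate s f, X.left_mem s f f.2⟩ = μ f
  map_right : ∀ (s : S) (f : X.toSubmodule), μ ⟨rightTranslate s f, X.right_mem s f f.2⟩ = μ f

/-! ### Right reversible semigroups and their order -/

/-- Any two closed left ideals `cl(Sa)` and `cl(Sb)` meet. -/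
def RightReversible (S : Type*) [Semigroup S] [TopologicalSpace S] : Prop :=
  ∀ a b : S, (closure (range fun s : S => s * a) ∩ closure (range fun s : S => s * b)).Nonempty

/-- The order `a ≤ b ↔ cl(Sb) ∪ {b} ⊆ cl(Sa) ∪ {a}` on `S`. -/
abbrev leftIdealPreorder (S : Type*) [Semigroup S] [TopologicalSpace S] : Preorder S where
  le a b := insert b (closure (range fun s : S => s * b)) ⊆
    insert a (closure (range fun s : S => s * a))
  le_refl _ := Subset.rfl
  le_trans _ _ _ hab hbc := hbc.trans hab

/-- The filter of tails of `S` with respect to that order: a net indexed by `S` converges when it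
converges along this filter. -/
def tails (S : Type*) [Semigroup S] [TopologicalSpace S] : Filter S :=
  @atTop S (leftIdealPreorder S)

/-! ### Representations on a subset of a Hilbert space -/

/-- A representation of `S` on `C` by self-maps. -/
def IsRepresentation {S Y : Type*} [Semigroup S] (T : S → Y → Y) : Prop :=
  ∀ (s t : S) (x : Y), T (s * t) x = T s (T t x)

/-- Generalized hybrid self-maps of `C`. -/
def IsGeneralizedHybrid {H : Type*} [NormedAddCommGroup H] {C : Set H} (f : C → C) : Prop :=
  ∃ α β : ℝ, ∀ x y : C,
    α * ‖(f x : H) - f y‖ ^ 2 + (1 - α) * ‖(x : H) - f y‖ ^ 2 ≤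
      β * ‖(f x : H) - y‖ ^ 2 + (1 - β) * ‖(x : H) - y‖ ^ 2

/-- The set `A_C(𝒮)` of attractive points. -/
def attractivePoints {S H : Type*} [NormedAddCommGroup H] {C : Set H} (T : S → C → C) : Set H :=
  {a | ∀ (s : S) (x : C), ‖a - T s x‖ ≤ ‖a - x‖}

/-- The orbit of `x`, as a subset of `H`. -/
def orbit {S H : Type*} {C : Set H} (T : S → C → C) (x : C) : Set H :=
  range fun s : S => (T s x : H)

/-- `p` is a point of `D` nearest to `y`. -/
def IsNearestPoint {H : Type*} [NormedAddCommGroup H] (D : Set H) (y p : H) : Prop :=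
  p ∈ D ∧ ∀ z ∈ D, ‖y - p‖ ≤ ‖y - z‖

open Classical in
/-- The metric projection `P_D`. For a nonempty closed convex set `D` in a Hilbert space the nearest
point exists and is unique; the value is `0` when there is no nearest point. -/
def metricProj {H : Type*} [NormedAddCommGroup H] (D : Set H) (y : H) : H :=
  if h : ∃ p, IsNearestPoint D y p then h.choose else 0

/-- `v` is the mean value `T_μ x` of the orbit map `u : s ↦ T_s x`: for each `y ∈ H` the function
`s ↦ ⟨T_s x | y⟩` (linear in `T_s x`) belongs to `X`, and its mean is `⟨v | y⟩`. -/
def IsMeanValue {S H : Type*} [Semigroup S] [TopologicalSpace S] [SeparatelyContinuousMul S]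
    [NormedAddCommGroup H] [InnerProductSpace ℂ H] (X : InvariantSubspace S)
    (μ : X.toSubmodule →L[ℂ] ℂ) (u : S → H) (v : H) : Prop :=
  ∀ y : H, ∃ f : X.toSubmodule, (∀ s, (f : S →ᵇ ℂ) s = inner ℂ y (u s)) ∧ μ f = inner ℂ y v

theorem IsMeanValue.unique {S H : Type*} [Semigroup S] [TopologicalSpace S]
    [SeparatelyContinuousMul S] [NormedAddCommGroup H] [InnerProductSpace ℂ H]
    {X : InvariantSubspace S} {μ : X.toSubmodule →L[ℂ] ℂ} {u : S → H} {v w : H}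
    (hv : IsMeanValue X μ u v) (hw : IsMeanValue X μ u w) : v = w := by
  refine ext_inner_left ℂ fun y => ?_
  obtain ⟨f, hf, hfv⟩ := hv y
  obtain ⟨g, hg, hgw⟩ := hw y
  have hfg : f = g := Subtype.ext (BoundedContinuousFunction.ext fun s => by rw [hf, hg])
  rw [← hfv, ← hgw, hfg]

/-! ### The weak topology on `C` -/

/-- The set `C`, to be equipped with the weak topology (and weak uniformity) of `H`. -/
def Weakly {H : Type*} (C : Set H) : Type _ := C

/-- The underlying vector of a point of `C`. -/
def Weakly.val {H : Type*} {C : Set H} (x : Weakly C) : H := Subtype.val x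

/-- The weak uniformity: the coarsest one for which all continuous linear functionals are uniformly
continuous. -/
instance {H : Type*} [NormedAddCommGroup H] [InnerProductSpace ℂ H] (C : Set H) :
    UniformSpace (Weakly C) :=
  UniformSpace.comap (fun (x : Weakly C) (φ : StrongDual ℂ H) => φ x.val) inferInstance

/-- The topology of the weak uniformity is the one induced by the weak topology of `H`. -/
theorem weakly_topology_eq {H : Type*} [NormedAddCommGroup H] [InnerProductSpace ℂ H] (C : Set H) :
    (inferInstance : TopologicalSpace (Weakly C)) =
      TopologicalSpace.induced (fun x : Weakly C => toWeakSpace ℂ H x.val) inferInstance := by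
  refine Eq.trans ?_ (induced_compose (f := fun x : Weakly C => toWeakSpace ℂ H x.val)
    (g := fun (w : WeakSpace ℂ H) (φ : StrongDual ℂ H) => (topDualPairing ℂ H).flip w φ)).symm
  rfl

/-- The action of `s` on `C`, seen as a self-map of `C` with the weak topology. -/
def weakAct {S H : Type*} {C : Set H} (T : S → C → C) : S → Weakly C → Weakly C := T

/-- The closure of the orbit of `x` in `C`, with respect to the weak topology of `C`. -/
def weakOrbitClosure {S H : Type*} [NormedAddCommGroup H] [InnerProductSpace ℂ H] {C : Set H}
    (T : S → C → C) (x : C) : Set (Weakly C) :=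
  closure (range fun s : S => weakAct T s x)

/-- Each bounded orbit is relatively weakly compact in `C`. -/
def BoundedOrbitsWeaklyCompact {S H : Type*} [NormedAddCommGroup H] [InnerProductSpace ℂ H]
    {C : Set H} (T : S → C → C) : Prop :=
  ∀ x : C, Bornology.IsBounded (orbit T x) → IsCompact (weakOrbitClosure T x)

/-- The maps `a s`, restricted to `K`, are quasi-equicontinuous: every pointwise limit of them
is continuous on `K`. -/
def QuasiEquicontinuousOn {S Y : Type*} [TopologicalSpace Y] (a : S → Y → Y) (K : Set Y) : Prop :=
  ∀ φ ∈ closure (range fun s : S => K.domRestrict (a s)), Continuous φ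

/-- The four cases for the function space `X` and the action. -/
def AdmissibleCase {S H : Type*} [Semigroup S] [TopologicalSpace S] [SeparatelyContinuousMul S]
    [NormedAddCommGroup H] [InnerProductSpace ℂ H] {C : Set H} (T : S → C → C)
    (X : InvariantSubspace S) : Prop :=
  (X = Cb S) ∨
  (X = LUC S ∧ BoundedOrbitsWeaklyCompact T ∧
    Continuous fun p : S × Weakly C => weakAct T p.1 p.2) ∨
  (X = AP S ∧ BoundedOrbitsWeaklyCompact T ∧ Equicontinuous (weakAct T)) ∨
  (X = WAP S ∧ BoundedOrbitsWeaklyCompact T ∧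
    ∀ x : C, Bornology.IsBounded (orbit T x) →
      QuasiEquicontinuousOn (weakAct T) (weakOrbitClosure T x))

end

end HybridErgodic

open HybridErgodic

namespace HybridErgodic

/-! ### Metric projections and Fejér monotone nets -/

section Projection

variable {F : Type*} [NormedAddCommGroup F] [InnerProductSpace ℝ F]

/-! The mean value `v` of a bounded orbit is a Riesz representative, once the coefficients `s ↦ ⟨T_s
x | y⟩` are known to lie in `X`. In cases 2–4 the left translates of a coefficient are pulled back
from functions on the compact weak orbit closure. There joint continuity, Arzelà–Ascoli, or the
Grothendieck-type `continuous_toWeakSpace_of_pointwise` gives the required regularity.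

That `v` is attractive follows by telescoping. For generalized hybrid `T_s`, an affine function of
`T_t x`, whose value at `v` is `‖v - T_s z‖² - ‖v - z‖²`, is at most `A t - A (s * t)` with `A`
bounded. Summing along `t, st, s²t, …` and averaging, left invariance bounds `n` times that value
independently of `n`, so it is nonpositive (`IsGeneralizedHybrid.norm_meanValue_sub_le`). Only
linear functionals of the orbit are averaged, so squared norms need not belong to `X`.

Orbits are Fejér monotone with respect to the closed convex set of attractive points, so their
projections converge to some `q` (`exists_tendsto_metricProj`). The variational inequality at `q`,
averaged over a tail by right invariance, gives `‖v - q‖² ≤ 0`. For convex `C`, projecting an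
attractive point onto `C` gives a common fixed point. -/

theorem IsNearestPoint.inner_le_zero {D : Set F} (hD : Convex ℝ D) {y p z : F}
    (hp : IsNearestPoint D y p) (hz : z ∈ D) : inner ℝ (y - p) (z - p) ≤ 0 := by
  have : Nonempty D := ⟨⟨p, hp.1⟩⟩
  refine (norm_eq_iInf_iff_real_inner_le_zero hD hp.1).1 ?_ z hz
  refine le_antisymm (le_ciInf fun w => hp.2 w w.2) ?_
  exact ciInf_le (f := fun w : D => ‖y - w‖) ⟨0, forall_mem_range.2 fun _ => norm_nonneg _⟩ ⟨p, hp.1⟩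

theorem IsNearestPoint.sq_add_sq_le {D : Set F} (hD : Convex ℝ D) {y p z : F}
    (hp : IsNearestPoint D y p) (hz : z ∈ D) : ‖y - p‖ ^ 2 + ‖p - z‖ ^ 2 ≤ ‖y - z‖ ^ 2 := by
  have h := hp.inner_le_zero hD hz
  have e : y - z = (y - p) - (z - p) := by abel
  rw [e, norm_sub_sq_real (y - p), norm_sub_rev p z]
  linarith

theorem exists_isNearestPoint [CompleteSpace F] {D : Set F} (hne : D.Nonempty) (hcl : IsClosed D)
    (hD : Convex ℝ D) (y : F) : ∃ p, IsNearestPoint D y p := by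
  obtain ⟨p, hp, h⟩ := exists_norm_eq_iInf_of_complete_convex hne hcl.isComplete hD y
  refine ⟨p, hp, fun z hz => h ▸ ?_⟩
  exact ciInf_le (f := fun w : D => ‖y - w‖) ⟨0, forall_mem_range.2 fun _ => norm_nonneg _⟩ ⟨z, hz⟩

theorem isNearestPoint_metricProj [CompleteSpace F] {D : Set F} (hne : D.Nonempty)
    (hcl : IsClosed D) (hD : Convex ℝ D) (y : F) : IsNearestPoint D y (metricProj D y) := by
  have h := exists_isNearestPoint hne hcl hD y
  rw [metricProj, dif_pos h]
  exact h.choose_spec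

/-- The projections of a Fejér monotone net onto `D` converge. -/
theorem exists_tendsto_metricProj [CompleteSpace F] {ι : Type*} [Preorder ι] [IsDirectedOrder ι]
    [Nonempty ι] {D : Set F} (hne : D.Nonempty) (hcl : IsClosed D) (hD : Convex ℝ D) (u : ι → F)
    (hu : ∀ a ∈ D, ∀ i j, i ≤ j → ‖u j - a‖ ≤ ‖u i - a‖) :
    ∃ q ∈ D, Tendsto (fun i => metricProj D (u i)) atTop (𝓝 q) ∧
      ∀ a ∈ D, ∀ ε > 0, ∃ i₀, ∀ i, i₀ ≤ i → inner ℝ (u i - q) (a - q) ≤ ε := by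
  set p : ι → F := fun i => metricProj D (u i) with hp
  have hpn : ∀ i, IsNearestPoint D (u i) (p i) := fun i => isNearestPoint_metricProj hne hcl hD _
  set d : ι → ℝ := fun i => ‖u i - p i‖ ^ 2 with hd
  -- `p i` competes with the nearest point `p j` of `u j`, and `u j` is no farther from it than `u
  -- i`. Since `d` decreases to a limit, this makes `p` Cauchy.
  have key : ∀ i j, i ≤ j → d j + ‖p j - p i‖ ^ 2 ≤ d i := fun i j hij =>
    ((hpn j).sq_add_sq_le hD (hpn i).1).trans
      (pow_le_pow_left₀ (norm_nonneg _) (hu _ (hpn i).1 i j hij) 2)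
  have hanti : Antitone d := fun i j hij => by nlinarith [key i j hij, sq_nonneg ‖p j - p i‖]
  have hlim : Tendsto d atTop (𝓝 (⨅ i, d i)) :=
    tendsto_atTop_ciInf hanti ⟨0, forall_mem_range.2 fun _ => sq_nonneg _⟩
  have hle : ∀ i, (⨅ i, d i) ≤ d i := fun i =>
    ciInf_le ⟨0, forall_mem_range.2 fun _ => sq_nonneg _⟩ i
  have hcauchy : Cauchy (map p atTop) := by
    rw [Metric.cauchy_iff]
    refine ⟨inferInstance, fun ε hε => ?_⟩
    have : ∀ᶠ i in atTop, d i < (⨅ i, d i) + (ε / 2) ^ 2 :=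
      hlim.eventually_lt_const (by have := pow_pos (half_pos hε) 2; linarith)
    obtain ⟨i, hi⟩ := this.exists
    have hc : ∀ j, i ≤ j → ‖p j - p i‖ < ε / 2 := fun j hij => by
      refine lt_of_pow_lt_pow_left₀ 2 (half_pos hε).le ?_
      linarith [key i j hij, hle j]
    refine ⟨p '' Ici i, image_mem_map (Ici_mem_atTop i), ?_⟩
    rintro _ ⟨j, hj, rfl⟩ _ ⟨k, hk, rfl⟩
    calc dist (p j) (p k) ≤ dist (p j) (p i) + dist (p k) (p i) := dist_triangle_right _ _ _
      _ < ε / 2 + ε / 2 := by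
        simp only [dist_eq_norm]
        exact add_lt_add (hc j hj) (hc k hk)
      _ = ε := add_halves ε
  obtain ⟨q, hq⟩ := CompleteSpace.complete hcauchy
  have hq : Tendsto p atTop (𝓝 q) := hq
  have hqD : q ∈ D := hcl.mem_of_tendsto hq (Eventually.of_forall fun i => (hpn i).1)
  refine ⟨q, hqD, hq, fun a ha ε hε => ?_⟩
  obtain ⟨i₁⟩ := ‹Nonempty ι›
  set M := ‖u i₁ - p i₁‖ + ‖a - q‖ + 1 with hM
  have hM0 : 0 < M := by positivity
  have hq' : ∀ᶠ i in atTop, ‖p i - q‖ < ε / M := by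
    have := (tendsto_iff_norm_sub_tendsto_zero.1 hq)
    exact this.eventually_lt_const (div_pos hε hM0)
  obtain ⟨i₀, hi₀⟩ := (hq'.and (eventually_ge_atTop i₁)).exists_forall_of_atTop
  refine ⟨i₀, fun i hi => ?_⟩
  obtain ⟨h1, h2⟩ := hi₀ i hi
  have h3 : ‖u i - p i‖ ≤ ‖u i₁ - p i₁‖ :=
    ((hpn i).2 _ (hpn i₁).1).trans (hu _ (hpn i₁).1 _ _ h2)
  have h4 := (hpn i).inner_le_zero hD ha
  -- The first term is nonpositive by the obtuse angle at `p i`; the other two are together at most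
  -- `‖p i - q‖ * M`.
  have e : inner ℝ (u i - q) (a - q) = inner ℝ (u i - p i) (a - p i) +
      inner ℝ (u i - p i) (p i - q) + inner ℝ (p i - q) (a - q) := by
    rw [← inner_add_right, ← sub_add_sub_cancel (u i) (p i) q, inner_add_left]
    simp
  have h5 := real_inner_le_norm (u i - p i) (p i - q)
  have h6 := real_inner_le_norm (p i - q) (a - q)
  have h7 : ‖u i - p i‖ * ‖p i - q‖ ≤ ‖u i₁ - p i₁‖ * ‖p i - q‖ := by gcongr
  have h8 : ‖p i - q‖ * M ≤ ε := by
    rw [lt_div_iff₀ hM0] at h1; exact h1.le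
  nlinarith [norm_nonneg (p i - q)]

end Projection

/-! ### The order on a right reversible semigroup -/

section Order

variable {S : Type*} [Semigroup S] [TopologicalSpace S] [SeparatelyContinuousMul S]

theorem closure_leftIdeal_subset {a c : S} (hc : c ∈ closure (range fun s : S => s * a)) :
    closure (range fun s : S => s * c) ⊆ closure (range fun s : S => s * a) := by
  refine closure_minimal ?_ isClosed_closure
  rintro _ ⟨s, rfl⟩
  refine map_mem_closure (f := fun t => s * t)
    SeparatelyContinuousMul.continuous_const_mul hc ?_
  rintro _ ⟨t, rfl⟩
  exact ⟨s * t, mul_assoc _ _ _⟩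

theorem leftIdealPreorder_le_of_mem {a c : S} (hc : c ∈ closure (range fun s : S => s * a)) :
    (leftIdealPreorder S).le a c :=
  insert_subset (mem_insert_of_mem _ hc)
    ((closure_leftIdeal_subset hc).trans (subset_insert _ _))

theorem leftIdealPreorder_le_mul (s a : S) : (leftIdealPreorder S).le a (s * a) :=
  leftIdealPreorder_le_of_mem (subset_closure ⟨s, rfl⟩)

theorem RightReversible.isDirectedOrder (hS : RightReversible S) :
    @IsDirectedOrder S (leftIdealPreorder S).toLE :=
  letI := leftIdealPreorder S
  ⟨fun a b =>
    let ⟨c, hc⟩ := hS a b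
    ⟨c, leftIdealPreorder_le_of_mem hc.1, leftIdealPreorder_le_of_mem hc.2⟩⟩

end Order

/-! ### Invariant means -/

section Mean

variable {S : Type*} [Semigroup S] [TopologicalSpace S] [SeparatelyContinuousMul S]
  {X : InvariantSubspace S} {μ : X.toSubmodule →L[ℂ] ℂ}

theorem IsInvariantMean.nonempty (hμ : IsInvariantMean X μ) : Nonempty S := by
  by_contra h
  rw [not_nonempty_iff] at h
  have h1 : (⟨1, X.one_mem⟩ : X.toSubmodule) = 0 := by
    ext s; exact isEmptyElim s
  have := hμ.map_one
  rw [h1, map_zero] at this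
  exact zero_ne_one this

/-- A mean does not increase upper bounds of real parts. -/
theorem IsInvariantMean.re_le (hμ : IsInvariantMean X μ) {f : X.toSubmodule} {c : ℝ}
    (hf : ∀ s, ((f : S →ᵇ ℂ) s).re ≤ c) : (μ f).re ≤ c := by
  have : Nonempty S := hμ.nonempty
  set e : X.toSubmodule := ⟨1, X.one_mem⟩ with he
  by_contra! hlt
  set δ := (μ f).re - c with hδ
  have hδ0 : 0 < δ := sub_pos.2 hlt
  set M := ‖(f : S →ᵇ ℂ)‖ + |c| + 1 with hM
  have hM0 : 0 < M := by positivity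
  -- Shifting `f` by the constant `R - c` bounds its norm by `√(R² + M²)`, while its mean has real
  -- part `R + δ`. This `R` makes `2Rδ > M²`, a contradiction.
  set R := M ^ 2 / δ + M with hR
  have hR0 : 0 < R := by positivity
  have hbound : ∀ r : ℝ, ‖μ (f + (r : ℂ) • e)‖ ≤ ‖((f + (r : ℂ) • e : X.toSubmodule) : S →ᵇ ℂ)‖ :=
    fun r => by
      have := μ.le_opNorm (f + (r : ℂ) • e)
      rwa [hμ.norm_eq_one, one_mul] at this
  have h1 := hbound (R - c)
  have h2 : ‖((f + ((R - c : ℝ) : ℂ) • e : X.toSubmodule) : S →ᵇ ℂ)‖ ^ 2 ≤ R ^ 2 + M ^ 2 := by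
    have h3 : ‖((f + ((R - c : ℝ) : ℂ) • e : X.toSubmodule) : S →ᵇ ℂ)‖ ≤ √(R ^ 2 + M ^ 2) := by
      rw [BoundedContinuousFunction.norm_le (Real.sqrt_nonneg _)]
      intro s
      refine Real.le_sqrt_of_sq_le ?_
      have hv : ((f + ((R - c : ℝ) : ℂ) • e : X.toSubmodule) : S →ᵇ ℂ) s
          = (f : S →ᵇ ℂ) s + ((R - c : ℝ) : ℂ) := by simp [he]
      rw [hv, ← Complex.normSq_eq_norm_sq, Complex.normSq_apply]
      simp only [Complex.add_re, Complex.add_im, Complex.ofReal_re, Complex.ofReal_im, add_zero]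
      have h4 := (f : S →ᵇ ℂ).norm_coe_le_norm s
      have h5 := (Complex.abs_re_le_norm ((f : S →ᵇ ℂ) s)).trans h4
      have h6 := (Complex.abs_im_le_norm ((f : S →ᵇ ℂ) s)).trans h4
      have h7 := hf s
      have h8 : M ≤ R := by rw [hR]; have : 0 ≤ M ^ 2 / δ := by positivity
                            linarith
      have h9 : ((f : S →ᵇ ℂ) s).im ^ 2 ≤ M ^ 2 := by
        rw [sq_le_sq, abs_of_pos hM0]; linarith [abs_nonneg c]
      have h10 : (((f : S →ᵇ ℂ) s).re + (R - c)) ^ 2 ≤ R ^ 2 := by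
        rw [sq_le_sq, abs_of_pos hR0, abs_le]
        have := abs_le.1 h5
        have := abs_le.1 (le_refl |c|)
        constructor <;> linarith
      nlinarith
    calc _ ≤ √(R ^ 2 + M ^ 2) ^ 2 := pow_le_pow_left₀ (norm_nonneg _) h3 2
      _ = _ := Real.sq_sqrt (by positivity)
  have h3 : (μ (f + ((R - c : ℝ) : ℂ) • e)).re = R + δ := by
    rw [map_add, map_smul, hμ.map_one]
    simp [hδ]; ring
  have h4 : (R + δ) ≤ ‖μ (f + ((R - c : ℝ) : ℂ) • e)‖ := h3 ▸ Complex.re_le_norm _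
  have h5 : (R + δ) ^ 2 ≤ R ^ 2 + M ^ 2 :=
    (pow_le_pow_left₀ (by positivity) (h4.trans h1) 2).trans h2
  have h6 : R * δ = M ^ 2 + M * δ := by rw [hR]; field_simp
  nlinarith [mul_pos hM0 hδ0, sq_nonneg M]

end Mean

/-! ### Weak compactness in spaces of continuous functions -/

section WeakCompactness

/-- By Riesz–Markov, `Ψ` is integration against a finite measure, so dominated convergence applies.
-/
theorem tendsto_zero_of_positive {M : Type*} [TopologicalSpace M] [CompactSpace M] [T2Space M]
    (Ψ : (M →ᵇ ℝ) →ₗ[ℝ] ℝ) (hΨ : ∀ f : M →ᵇ ℝ, (∀ x, 0 ≤ f x) → 0 ≤ Ψ f) (f : ℕ → M →ᵇ ℝ) (B : ℝ)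
    (hB : ∀ n x, ‖f n x‖ ≤ B) (hf : ∀ x, Tendsto (fun n => f n x) atTop (𝓝 0)) :
    Tendsto (fun n => Ψ (f n)) atTop (𝓝 0) := by
  let : MeasurableSpace M := borel M
  have : BorelSpace M := ⟨rfl⟩
  let L : CompactlySupportedContinuousMap M ℝ →ₗ[ℝ] ℝ :=
    { toFun := fun g => Ψ (BoundedContinuousFunction.mkOfCompact g.toContinuousMap)
      map_add' := fun g h => by
        rw [← map_add]; congr 1
      map_smul' := fun c g => by
        rw [← map_smul]; congr 1 }
  let Λ := PositiveLinearMap.mk₀ L fun g hg => hΨ _ (CompactlySupportedContinuousMap.le_def.1 hg)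
  have hint : ∀ g : M →ᵇ ℝ, Ψ g = ∫ x, g x ∂(RealRMK.rieszMeasure Λ) := fun g =>
    (RealRMK.integral_rieszMeasure Λ
      ⟨g.toContinuousMap, HasCompactSupport.of_compactSpace _⟩).symm
  simp only [hint]
  rw [← MeasureTheory.integral_zero M ℝ (μ := RealRMK.rieszMeasure Λ)]
  refine MeasureTheory.tendsto_integral_of_dominated_convergence (fun _ => B)
    (fun n => (f n).continuous.aestronglyMeasurable) (MeasureTheory.integrable_const B)
    (fun n => Eventually.of_forall (hB n)) (Eventually.of_forall hf)

/-- The real-linear isometry `f ↦ ((z, k) ↦ Re (z f(k)))`. -/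
noncomputable def circleRe (K : Type*) [TopologicalSpace K] [CompactSpace K] :
    (K →ᵇ ℂ) →ₗ[ℝ] (Circle × K →ᵇ ℝ) where
  toFun f := BoundedContinuousFunction.mkOfCompact
    ⟨fun p => ((p.1 : ℂ) * f p.2).re, by fun_prop⟩
  map_add' f g := by ext p; simp; ring
  map_smul' c f := by ext p; simp; ring

@[simp]
theorem circleRe_apply {K : Type*} [TopologicalSpace K] [CompactSpace K] (f : K →ᵇ ℂ)
    (p : Circle × K) : circleRe K f p = ((p.1 : ℂ) * f p.2).re := rfl

theorem exists_circleRe_eq_norm {K : Type*} [TopologicalSpace K] [CompactSpace K] (f : K →ᵇ ℂ)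
    (k : K) : ∃ z : Circle, circleRe K f (z, k) = ‖f k‖ := by
  refine ⟨Circle.exp (-(f k).arg), ?_⟩
  have h := Complex.norm_mul_exp_arg_mul_I (f k)
  rw [circleRe_apply]
  have : ((Circle.exp (-(f k).arg) : Circle) : ℂ) * f k = ‖f k‖ := by
    nth_rewrite 2 [← h]
    rw [Circle.coe_exp, mul_left_comm, ← Complex.exp_add]
    simp
  rw [this, Complex.ofReal_re]

/-- Hahn–Banach with the sublinear bound `F ↦ ‖φ‖ * sup F` instead of the norm: applied to `-F`, it
forces positivity of the extension. It dominates `Re φ` because rotating by the circle factor makes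
`sup (circleRe K f)` at least `‖f‖`. This avoids decomposing a complex measure. -/
theorem exists_positive_extension {K : Type*} [TopologicalSpace K] [CompactSpace K] [Nonempty K]
    (φ : (K →ᵇ ℂ) →L[ℂ] ℂ) : ∃ Ψ : (Circle × K →ᵇ ℝ) →ₗ[ℝ] ℝ,
      (∀ F : Circle × K →ᵇ ℝ, (∀ x, 0 ≤ F x) → 0 ≤ Ψ F) ∧
      ∀ f, Ψ (circleRe K f) = (φ f).re := by
  have hbdd : ∀ F : Circle × K →ᵇ ℝ, BddAbove (range F) := fun F =>
    ⟨‖F‖, forall_mem_range.2 fun x => (le_abs_self _).trans (F.norm_coe_le_norm x)⟩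
  have hinj : Function.Injective (circleRe K) := by
    rw [injective_iff_map_eq_zero]
    intro f hf
    ext k
    obtain ⟨z, hz⟩ := exists_circleRe_eq_norm f k
    rw [hf] at hz
    exact norm_eq_zero.1 hz.symm
  let e := LinearEquiv.ofInjective (circleRe K) hinj
  let r : (K →ᵇ ℂ) →ₗ[ℝ] ℝ := Complex.reLm ∘ₗ (φ : (K →ᵇ ℂ) →ₗ[ℂ] ℂ).restrictScalars ℝ
  obtain ⟨Ψ, hΨ, hle⟩ := exists_extension_of_le_sublinear
    ⟨LinearMap.range (circleRe K), r ∘ₗ e.symm.toLinearMap⟩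
    (fun F => ‖φ‖ * ⨆ x, F x) (fun c hc F => by
      have : (⨆ x, (c • F) x) = c * ⨆ x, F x := by
        rw [Real.mul_iSup_of_nonneg hc.le]; rfl
      rw [this]; ring)
    (fun F G => by
      rw [← mul_add]
      refine mul_le_mul_of_nonneg_left (ciSup_le fun x => ?_) (norm_nonneg _)
      exact add_le_add (le_ciSup (hbdd F) x) (le_ciSup (hbdd G) x))
    (by
      rintro ⟨_, f, rfl⟩
      have he : e.symm ⟨circleRe K f, ⟨f, rfl⟩⟩ = f := e.symm_apply_apply f
      change r (e.symm ⟨circleRe K f, ⟨f, rfl⟩⟩) ≤ _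
      rw [he]
      calc (φ f).re ≤ ‖φ f‖ := Complex.re_le_norm _
        _ ≤ ‖φ‖ * ‖f‖ := φ.le_opNorm f
        _ ≤ _ := by
          refine mul_le_mul_of_nonneg_left ?_ (norm_nonneg _)
          rw [BoundedContinuousFunction.norm_le_of_nonempty]
          intro k
          obtain ⟨z, hz⟩ := exists_circleRe_eq_norm f k
          rw [← hz]
          exact le_ciSup (hbdd (circleRe K f)) (z, k))
  refine ⟨Ψ, fun F hF => ?_, fun f => ?_⟩
  · have h := hle (-F)
    have h2 : (⨆ x, (-F) x) ≤ 0 := Real.iSup_nonpos fun x => by simpa using hF x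
    rw [map_neg] at h
    nlinarith [norm_nonneg φ]
  · rw [hΨ ⟨circleRe K f, ⟨f, rfl⟩⟩]
    change r (e.symm ⟨circleRe K f, ⟨f, rfl⟩⟩) = _
    rw [show e.symm ⟨circleRe K f, ⟨f, rfl⟩⟩ = f from e.symm_apply_apply f]
    rfl

/-- A bounded pointwise null sequence of continuous functions on a compact space is weakly null. -/
theorem tendsto_zero_of_pointwise {K : Type*} [TopologicalSpace K] [CompactSpace K] [T2Space K]
    (φ : (K →ᵇ ℂ) →L[ℂ] ℂ) (f : ℕ → K →ᵇ ℂ) (B : ℝ) (hB : ∀ n, ‖f n‖ ≤ B)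
    (hf : ∀ k, Tendsto (fun n => f n k) atTop (𝓝 0)) :
    Tendsto (fun n => φ (f n)) atTop (𝓝 0) := by
  rcases isEmpty_or_nonempty K with hK | hK
  · have : ∀ n, f n = 0 := fun n => by ext k; exact isEmptyElim k
    simp [this]
  have hre : ∀ ψ : (K →ᵇ ℂ) →L[ℂ] ℂ, Tendsto (fun n => (ψ (f n)).re) atTop (𝓝 0) := fun ψ => by
    obtain ⟨Ψ, hpos, hΨ⟩ := exists_positive_extension ψ
    simp only [← hΨ]
    have hle : ∀ n (p : Circle × K), ‖circleRe K (f n) p‖ ≤ ‖f n p.2‖ := fun n p => by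
      rw [circleRe_apply, Real.norm_eq_abs]
      refine (Complex.abs_re_le_norm _).trans_eq ?_
      rw [norm_mul, Circle.norm_coe, one_mul]
    refine tendsto_zero_of_positive Ψ hpos _ B
      (fun n p => (hle n p).trans (((f n).norm_coe_le_norm _).trans (hB n))) fun p => ?_
    exact squeeze_zero_norm (fun n => hle n p) (tendsto_zero_iff_norm_tendsto_zero.1 (hf p.2))
  -- The imaginary part of `φ` is the real part of `-iφ`.
  have him := hre ((-Complex.I) • φ)
  have h := (Complex.continuous_ofReal.tendsto _).comp (hre φ) |>.add
    (((Complex.continuous_ofReal.tendsto _).comp him).mul_const Complex.I)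
  simp only [Complex.ofReal_zero, zero_mul, add_zero] at h
  refine h.congr fun n => ?_
  apply Complex.ext <;> simp

/-- A separately continuous bounded function on a product of compact spaces induces a map into
the continuous functions on one factor that is continuous for the weak topology. -/
theorem continuous_toWeakSpace_of_pointwise {Q K : Type*} [TopologicalSpace Q] [CompactSpace Q]
    [TopologicalSpace K] [CompactSpace K] [T2Space K] (b : Q → K →ᵇ ℂ)
    (hb : ∀ k, Continuous fun q => b q k) (B : ℝ) (hB : ∀ q, ‖b q‖ ≤ B) :
    Continuous fun q => toWeakSpace ℂ (K →ᵇ ℂ) (b q) := by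
  classical
  refine WeakBilin.continuous_of_continuous_eval _ fun φ => ?_
  change Continuous fun q => φ (b q)
  rw [continuous_iff_continuousAt]
  intro q₀
  by_contra hnot
  rw [ContinuousAt, Metric.tendsto_nhds] at hnot
  push Not at hnot
  obtain ⟨ε, hε, hfreq⟩ := hnot
  -- If continuity fails at `q₀`, bad points exist in every basic pointwise neighbourhood. The aim
  -- is a sequence of bad points converging pointwise on all of `K`, to which dominated convergence
  -- applies.
  have hc : ∀ (F : Finset K) (n : ℕ), ∃ q, (∀ x ∈ F, ‖b q x - b q₀ x‖ < 1 / ((n : ℝ) + 1)) ∧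
      ε ≤ ‖φ (b q) - φ (b q₀)‖ := fun F n => by
    have hev : ∀ᶠ q in 𝓝 q₀, ∀ x ∈ F, ‖b q x - b q₀ x‖ < 1 / ((n : ℝ) + 1) := by
      rw [eventually_all_finset]
      intro x _
      have := Metric.tendsto_nhds.1 ((hb x).tendsto q₀) _ (Nat.one_div_pos_of_nat (n := n))
      simpa only [dist_eq_norm] using this
    obtain ⟨q, hq, hq'⟩ := (hfreq.and_eventually hev).exists
    exact ⟨q, hq', by simpa only [dist_eq_norm] using hq⟩
  choose c hc1 hc2 using hc
  -- Finitely many functions `b q` cannot tell points of `K` from a finite net, up to `1 / (n + 1)`.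
  have hN : ∀ (L : Finset Q) (n : ℕ), ∃ N : Finset K, ∀ k, ∃ x ∈ N, ∀ q ∈ L,
      ‖b q k - b q x‖ < 1 / ((n : ℝ) + 1) := fun L n => by
    obtain ⟨N, hN⟩ := CompactSpace.elim_nhds_subcover
      (fun x : K => {k | ∀ q ∈ L, ‖b q k - b q x‖ < 1 / ((n : ℝ) + 1)}) fun x => by
        change ∀ᶠ k in 𝓝 x, ∀ q ∈ L, ‖b q k - b q x‖ < 1 / ((n : ℝ) + 1)
        rw [eventually_all_finset]
        intro q _
        have := Metric.tendsto_nhds.1 ((b q).continuous.tendsto x) _ (Nat.one_div_pos_of_nat (n := n))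
        simpa only [dist_eq_norm] using this
    refine ⟨N, fun k => ?_⟩
    have hk : k ∈ (⊤ : Set K) := trivial
    rw [← hN] at hk
    simpa using hk
  choose N hN using hN
  -- Alternate the two choices: add a bad point close to `q₀` on the current test set, then enlarge
  -- the test set by a net for all parameters chosen so far.
  let st : ℕ → Finset Q × Finset K := fun n => Nat.rec ({q₀}, ∅)
    (fun n p => (insert (c p.2 n) p.1, p.2 ∪ N (insert (c p.2 n) p.1) n)) n
  have hst : ∀ n, st (n + 1) = (insert (c (st n).2 n) (st n).1,
      (st n).2 ∪ N (insert (c (st n).2 n) (st n).1) n) := fun n => rfl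
  set q : ℕ → Q := fun n => c (st n).2 n with hq
  have hL : Monotone fun n => (st n).1 := monotone_nat_of_le_succ fun n => by
    rw [hst]; exact Finset.subset_insert _ _
  have hF : Monotone fun n => (st n).2 := monotone_nat_of_le_succ fun n => by
    rw [hst]; exact Finset.subset_union_left
  have hq₀ : ∀ n, q₀ ∈ (st n).1 := fun n => hL (Nat.zero_le n) (Finset.mem_singleton_self q₀)
  have hqL : ∀ i n, i ≤ n → q i ∈ (st (n + 1)).1 := fun i n hin =>
    hL (Nat.succ_le_succ hin) (by
      change q i ∈ (st (i + 1)).1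
      rw [hst]; exact Finset.mem_insert_self _ _)
  have hnet : ∀ n k, ∃ x ∈ (st (n + 1)).2, ∀ q' ∈ (st (n + 1)).1,
      ‖b q' k - b q' x‖ < 1 / ((n : ℝ) + 1) := fun n k => by
    obtain ⟨x, hx, hx'⟩ := hN (insert (c (st n).2 n) (st n).1) n k
    exact ⟨x, by rw [hst]; exact Finset.mem_union_right _ hx, by rw [hst]; exact hx'⟩
  have hconv : ∀ n, ∀ x ∈ (st n).2, Tendsto (fun m => b (q m) x) atTop (𝓝 (b q₀ x)) := by
    intro n x hx
    rw [tendsto_iff_norm_sub_tendsto_zero]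
    refine squeeze_zero' (Eventually.of_forall fun _ => norm_nonneg _) ?_
      (tendsto_one_div_add_atTop_nhds_zero_nat (𝕜 := ℝ))
    filter_upwards [eventually_ge_atTop n] with m hm
    exact (hc1 (st m).2 m x (hF hm hx)).le
  have hpt : ∀ k, Tendsto (fun m => b (q m) k) atTop (𝓝 (b q₀ k)) := by
    intro k
    rw [tendsto_iff_ultrafilter]
    intro U hU
    -- Let `q'` be a limit of the sequence `q` and `l` a limit of net points `x n` approximating
    -- `k`. All `b (q m)` and `b q₀` agree at `k` and `l`, hence so does `b q'`. Since `b q'` and `b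
    -- q₀` agree on the test points, they agree at `l`, and therefore at `k`.
    obtain ⟨q', -, hq'⟩ := isCompact_univ.ultrafilter_le_nhds (U.map q) (by simp)
    have hlim : ∀ y, Tendsto (fun m => b (q m) y) U (𝓝 (b q' y)) := fun y =>
      ((hb y).tendsto q').comp (show Tendsto q U (𝓝 q') from hq')
    have heqF : ∀ n, ∀ x ∈ (st n).2, b q' x = b q₀ x := fun n x hx =>
      tendsto_nhds_unique (hlim x) ((hconv n x hx).mono_left hU)
    choose x hxF hx using fun n => hnet n k
    obtain ⟨l, -, hl⟩ := isCompact_univ.ultrafilter_le_nhds (U.map x) (by simp)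
    have hl : Tendsto x U (𝓝 l) := hl
    have hsame : ∀ p : Q, (∃ n, ∀ m, n ≤ m → p ∈ (st (m + 1)).1) → b p l = b p k := by
      rintro p ⟨n, hn⟩
      refine tendsto_nhds_unique (((b p).continuous.tendsto l).comp hl) ?_
      refine Tendsto.mono_left ?_ hU
      rw [tendsto_iff_norm_sub_tendsto_zero]
      refine squeeze_zero' (Eventually.of_forall fun _ => norm_nonneg _) ?_
        (tendsto_one_div_add_atTop_nhds_zero_nat (𝕜 := ℝ))
      filter_upwards [eventually_ge_atTop n] with m hm
      rw [norm_sub_rev]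
      exact (hx m p (hn m hm)).le
    have h1 : b q₀ l = b q₀ k := hsame q₀ ⟨0, fun m _ => hq₀ (m + 1)⟩
    have h2 : b q' l = b q' k := by
      refine tendsto_nhds_unique (hlim l) ((hlim k).congr fun m => ?_)
      exact (hsame (q m) ⟨m, fun j hj => hqL m j hj⟩).symm
    have h3 : b q' l = b q₀ l := by
      refine tendsto_nhds_unique (((b q').continuous.tendsto l).comp hl) ?_
      refine (((b q₀).continuous.tendsto l).comp hl).congr fun m => ?_
      exact (heqF (m + 1) (x m) (hxF m)).symm
    have h4 : b q' k = b q₀ k := by rw [← h2, h3, h1]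
    exact h4 ▸ hlim k
  have hweak := tendsto_zero_of_pointwise φ (fun m => b (q m) - b q₀) (B + B)
    (fun m => (norm_sub_le _ _).trans (add_le_add (hB _) (hB _))) fun k => by
      have := (hpt k).sub_const (b q₀ k)
      simpa using this
  obtain ⟨m, hm⟩ := (Metric.tendsto_nhds.1 hweak ε hε).exists
  rw [dist_zero_right, map_sub] at hm
  exact absurd hm (not_lt.2 (hc2 (st m).2 m))

end WeakCompactness

/-! ### The weak topology on a subset of a Hilbert space -/

section WeakTopology

variable {H : Type*} [NormedAddCommGroup H] [InnerProductSpace ℂ H] {C : Set H}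

/-- A point of `C`, seen in `C` with the weak topology. -/
def toWeakly (c : C) : Weakly C := c

theorem continuous_toWeakly : Continuous (toWeakly : C → Weakly C) := by
  refine continuous_induced_rng.2 (continuous_pi fun φ => ?_)
  exact φ.continuous.comp continuous_subtype_val

theorem uniformContinuous_inner_val (y : H) :
    UniformContinuous fun z : Weakly C => inner ℂ y z.val := by
  have h : UniformContinuous fun (z : Weakly C) (φ : StrongDual ℂ H) => φ z.val :=
    uniformContinuous_comap
  exact uniformContinuous_pi.1 h (innerSL ℂ y)

theorem continuous_inner_val (y : H) : Continuous fun z : Weakly C => inner ℂ y z.val :=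
  (uniformContinuous_inner_val y).continuous

instance : T2Space (Weakly C) := by
  refine T2Space.of_injective_continuous (f := fun (z : Weakly C) (y : H) => inner ℂ y z.val) ?_
    (continuous_pi fun y => continuous_inner_val y)
  intro z w h
  exact Subtype.ext (ext_inner_left ℂ fun y => congrFun h y)

end WeakTopology

/-! ### Matrix coefficients of the action -/

noncomputable section Coefficients

variable {S H : Type*} [NormedAddCommGroup H] [InnerProductSpace ℂ H] {C : Set H}
  {T : S → C → C} {x : C}

/-- A weakly continuous map on the weak orbit closure, paired with `y`. -/
def pairing [CompactSpace (weakOrbitClosure T x)] (y : H)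
    (f : weakOrbitClosure T x → Weakly C) (hf : Continuous f) :
    weakOrbitClosure T x →ᵇ ℂ :=
  BoundedContinuousFunction.mkOfCompact
    ⟨fun k => inner ℂ y (f k).val, (continuous_inner_val y).comp hf⟩

theorem weakAct_mem_weakOrbitClosure [Semigroup S] (hT : IsRepresentation T) (s : S)
    (hs : Continuous ((weakOrbitClosure T x).domRestrict (weakAct T s))) {k : Weakly C}
    (hk : k ∈ weakOrbitClosure T x) : weakAct T s k ∈ weakOrbitClosure T x := by
  refine MapsTo.closure_of_continuousOn ?_ (continuousOn_iff_continuous_domRestrict.2 hs) hk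
  rintro _ ⟨t, rfl⟩
  exact ⟨s * t, hT s t x⟩

variable [TopologicalSpace S]

/-- The coefficient `s ↦ ⟨T_s x | y⟩` as a bounded continuous function. -/
def coefficient (hcont : Continuous fun s : S => T s x)
    (hb : Bornology.IsBounded (orbit T x)) (y : H) : S →ᵇ ℂ :=
  BoundedContinuousFunction.ofNormedAddCommGroup (fun s => inner ℂ y (T s x : H))
    (continuous_const.inner (continuous_subtype_val.comp hcont)) (‖y‖ * hb.exists_norm_le.choose)
    fun s => (norm_inner_le_norm _ _).trans
      (mul_le_mul_of_nonneg_left (hb.exists_norm_le.choose_spec _ ⟨s, rfl⟩) (norm_nonneg y))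

@[simp]
theorem coefficient_apply (hcont : Continuous fun s : S => T s x)
    (hb : Bornology.IsBounded (orbit T x)) (y : H) (s : S) :
    coefficient hcont hb y s = inner ℂ y (T s x : H) := rfl

/-- The orbit map into the weak orbit closure. -/
def orbitMap (hcont : Continuous fun s : S => T s x) : C(S, weakOrbitClosure T x) where
  toFun s := ⟨weakAct T s x, subset_closure ⟨s, rfl⟩⟩
  continuous_toFun := (continuous_toWeakly.comp hcont).subtype_mk _

variable [Semigroup S] [SeparatelyContinuousMul S]

/-- Pulling back along the orbit map is a bounded linear operator, so continuity and compactness of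
the translates can be checked on the compact orbit closure. -/
theorem leftTranslate_coefficient [CompactSpace (weakOrbitClosure T x)]
    (hT : IsRepresentation T) (hcont : Continuous fun s : S => T s x)
    (hb : Bornology.IsBounded (orbit T x)) (y : H) (s : S)
    (hs : Continuous ((weakOrbitClosure T x).domRestrict (weakAct T s))) :
    leftTranslate s (coefficient hcont hb y) =
      BoundedContinuousFunction.compContinuousCLM ℂ ℂ (orbitMap hcont)
        (pairing y ((weakOrbitClosure T x).domRestrict (weakAct T s)) hs) := by
  ext t
  rw [leftTranslate_apply, coefficient_apply, hT s t x]
  rfl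

theorem coefficient_mem_LUC [CompactSpace (weakOrbitClosure T x)]
    (hT : IsRepresentation T) (hcont : Continuous fun s : S => T s x)
    (hb : Bornology.IsBounded (orbit T x)) (y : H)
    (hj : Continuous fun p : S × Weakly C => weakAct T p.1 p.2) :
    coefficient hcont hb y ∈ (LUC S).toSubmodule := by
  have hs : ∀ s, Continuous ((weakOrbitClosure T x).domRestrict (weakAct T s)) := fun s =>
    hj.comp (continuous_const.prodMk continuous_subtype_val)
  change Continuous fun s : S => leftTranslate s (coefficient hcont hb y)
  simp only [fun s => leftTranslate_coefficient hT hcont hb y s (hs s)]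
  refine (ContinuousLinearMap.continuous _).comp ?_
  let F : C(S × weakOrbitClosure T x, ℂ) :=
    ⟨fun p => inner ℂ y (weakAct T p.1 p.2).val, (continuous_inner_val y).comp
      (hj.comp (continuous_fst.prodMk (continuous_subtype_val.comp continuous_snd)))⟩
  exact (ContinuousMap.linearIsometryBoundedOfCompact (weakOrbitClosure T x) ℂ ℂ).continuous.comp
    F.curry.continuous

theorem coefficient_mem_AP [CompactSpace (weakOrbitClosure T x)]
    (hT : IsRepresentation T) (hcont : Continuous fun s : S => T s x)
    (hb : Bornology.IsBounded (orbit T x)) (y : H) (he : Equicontinuous (weakAct T)) :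
    coefficient hcont hb y ∈ (AP S).toSubmodule := by
  have hs : ∀ s, Continuous ((weakOrbitClosure T x).domRestrict (weakAct T s)) := fun s =>
    (he.continuous s).comp continuous_subtype_val
  change IsCompact (closure (range fun s : S => leftTranslate s (coefficient hcont hb y)))
  set A := range fun s : S => pairing y ((weakOrbitClosure T x).domRestrict (weakAct T s)) (hs s)
    with hA
  have hc : IsCompact (closure A) := by
    refine BoundedContinuousFunction.arzela_ascoli
      ((fun z : Weakly C => inner ℂ y z.val) '' weakOrbitClosure T x)
      ((isCompact_iff_compactSpace.2 inferInstance).image (continuous_inner_val y)) A ?_ ?_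
    · rintro _ k ⟨s, rfl⟩
      exact ⟨_, weakAct_mem_weakOrbitClosure hT s (hs s) k.2, rfl⟩
    · intro k₀ U hU
      have h := he k₀.1 _ (uniformContinuous_inner_val y hU)
      filter_upwards [(continuous_subtype_val.tendsto k₀).eventually h] with k hk
      rintro ⟨_, s, rfl⟩
      exact hk s
  refine IsCompact.closure_of_subset (hc.image
    (BoundedContinuousFunction.compContinuousCLM ℂ ℂ (orbitMap hcont)).continuous) ?_
  rintro _ ⟨s, rfl⟩
  exact ⟨_, subset_closure ⟨s, rfl⟩, (leftTranslate_coefficient hT hcont hb y s (hs s)).symm⟩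

theorem coefficient_mem_WAP [CompactSpace (weakOrbitClosure T x)]
    (hT : IsRepresentation T) (hcont : Continuous fun s : S => T s x)
    (hb : Bornology.IsBounded (orbit T x)) (y : H)
    (hq : QuasiEquicontinuousOn (weakAct T) (weakOrbitClosure T x)) :
    coefficient hcont hb y ∈ (WAP S).toSubmodule := by
  have hs : ∀ s, Continuous ((weakOrbitClosure T x).domRestrict (weakAct T s)) := fun s =>
    hq _ (subset_closure ⟨s, rfl⟩)
  have hK : IsCompact (weakOrbitClosure T x) := isCompact_iff_compactSpace.2 inferInstance
  -- `Q` is compact by Tychonoff, and quasi-equicontinuity makes its members continuous, so the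
  -- pairing on `Q × K_x` is separately continuous.
  set Q : Set (weakOrbitClosure T x → Weakly C) :=
    closure (range fun s : S => (weakOrbitClosure T x).domRestrict (weakAct T s)) with hQ
  have hQK : Q ⊆ univ.pi fun _ => weakOrbitClosure T x := by
    refine closure_minimal ?_ (isClosed_set_pi fun _ _ => isClosed_closure)
    rintro _ ⟨s, rfl⟩ k -
    exact weakAct_mem_weakOrbitClosure hT s (hs s) k.2
  have hQc : IsCompact Q :=
    (isCompact_univ_pi fun _ => hK).of_isClosed_subset isClosed_closure hQK
  have : CompactSpace Q := isCompact_iff_compactSpace.1 hQc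
  obtain ⟨B, hB⟩ := (hK.image (continuous_inner_val y)).isBounded.exists_norm_le
  have hcb := continuous_toWeakSpace_of_pointwise (Q := Q) (fun q => pairing y q.1 (hq q.1 q.2))
    (fun k => (continuous_inner_val y).comp ((continuous_apply k).comp continuous_subtype_val))
    (max B 0) fun q => by
      rw [BoundedContinuousFunction.norm_le (le_max_right _ _)]
      intro k
      exact (hB _ ⟨_, hQK q.2 k trivial, rfl⟩).trans (le_max_left _ _)
  change IsCompact (closure (range fun s : S =>
    toWeakSpace ℂ (S →ᵇ ℂ) (leftTranslate s (coefficient hcont hb y))))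
  refine IsCompact.closure_of_subset (isCompact_univ.image ((WeakSpace.map
    (BoundedContinuousFunction.compContinuousCLM ℂ ℂ (orbitMap hcont))).continuous.comp hcb)) ?_
  rintro _ ⟨s, rfl⟩
  refine ⟨⟨_, subset_closure ⟨s, rfl⟩⟩, trivial, ?_⟩
  exact congrArg (toWeakSpace ℂ (S →ᵇ ℂ)) (leftTranslate_coefficient hT hcont hb y s (hs s)).symm

theorem AdmissibleCase.coefficient_mem {X : InvariantSubspace S} (hX : AdmissibleCase T X)
    (hT : IsRepresentation T) (hcont : Continuous fun s : S => T s x)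
    (hb : Bornology.IsBounded (orbit T x)) (y : H) :
    coefficient hcont hb y ∈ X.toSubmodule := by
  rcases hX with rfl | ⟨rfl, hc, h⟩ | ⟨rfl, hc, h⟩ | ⟨rfl, hc, h⟩
  · exact trivial
  all_goals have := isCompact_iff_compactSpace.1 (hc x hb)
  · exact coefficient_mem_LUC hT hcont hb y h
  · exact coefficient_mem_AP hT hcont hb y h
  · exact coefficient_mem_WAP hT hcont hb y (h x hb)

end Coefficients

attribute [local instance] InnerProductSpace.complexToReal

/-! ### Mean values of orbits -/

section MeanValue

variable {S H : Type*} [Semigroup S] [TopologicalSpace S] [SeparatelyContinuousMul S]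
  [NormedAddCommGroup H] [InnerProductSpace ℂ H] {X : InvariantSubspace S}
  {μ : X.toSubmodule →L[ℂ] ℂ}

theorem exists_isMeanValue [CompleteSpace H] {C : Set H} {T : S → C → C} {x : C}
    (μ : X.toSubmodule →L[ℂ] ℂ) (hcont : Continuous fun s : S => T s x)
    (hb : Bornology.IsBounded (orbit T x)) (hmem : ∀ y, coefficient hcont hb y ∈ X.toSubmodule) :
    ∃ v : H, IsMeanValue X μ (fun s => (T s x : H)) v := by
  obtain ⟨B, hB⟩ := hb.exists_norm_le
  -- The coefficient is conjugate-linear in `y`; conjugating its mean gives a linear functional for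
  -- the Riesz theorem.
  let L : H →ₗ[ℂ] ℂ :=
    { toFun := fun y => starRingEnd ℂ (μ ⟨coefficient hcont hb y, hmem y⟩)
      map_add' := fun y z => by
        have : (⟨coefficient hcont hb (y + z), hmem _⟩ : X.toSubmodule) =
            ⟨coefficient hcont hb y, hmem y⟩ + ⟨coefficient hcont hb z, hmem z⟩ := by
          ext s; simp
        rw [this, map_add, map_add]
      map_smul' := fun c y => by
        have : (⟨coefficient hcont hb (c • y), hmem _⟩ : X.toSubmodule) =
            starRingEnd ℂ c • ⟨coefficient hcont hb y, hmem y⟩ := by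
          ext s; simp [mul_comm]
        rw [this, map_smul, smul_eq_mul, map_mul]
        simp }
  let L' : StrongDual ℂ H := L.mkContinuous (‖μ‖ * max B 0) fun y => by
    change ‖starRingEnd ℂ (μ ⟨coefficient hcont hb y, hmem y⟩)‖ ≤ _
    rw [RCLike.norm_conj, mul_assoc]
    refine (μ.le_opNorm _).trans (mul_le_mul_of_nonneg_left ?_ (norm_nonneg _))
    change ‖coefficient hcont hb y‖ ≤ _
    rw [BoundedContinuousFunction.norm_le (by positivity), mul_comm]
    intro s
    refine (norm_inner_le_norm _ _).trans (mul_le_mul_of_nonneg_left ?_ (norm_nonneg y))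
    exact (hB _ ⟨s, rfl⟩).trans (le_max_left _ _)
  refine ⟨(InnerProductSpace.toDual ℂ H).symm L', fun y =>
    ⟨⟨coefficient hcont hb y, hmem y⟩, fun s => rfl, ?_⟩⟩
  rw [← inner_conj_symm, InnerProductSpace.toDual_symm_apply]
  change _ = starRingEnd ℂ (starRingEnd ℂ (μ ⟨coefficient hcont hb y, hmem y⟩))
  rw [Complex.conj_conj]

theorem IsMeanValue.mul_left (hμ : IsInvariantMean X μ) {u : S → H} {v : H}
    (hv : IsMeanValue X μ u v) (s : S) : IsMeanValue X μ (fun t => u (s * t)) v := fun y =>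
  let ⟨f, hf, hfv⟩ := hv y
  ⟨⟨leftTranslate s f, X.left_mem s f f.2⟩, fun t => hf (s * t), (hμ.map_left s f).trans hfv⟩

theorem IsMeanValue.mul_right (hμ : IsInvariantMean X μ) {u : S → H} {v : H}
    (hv : IsMeanValue X μ u v) (s : S) : IsMeanValue X μ (fun t => u (t * s)) v := fun y =>
  let ⟨f, hf, hfv⟩ := hv y
  ⟨⟨rightTranslate s f, X.right_mem s f f.2⟩, fun t => hf (t * s), (hμ.map_right s f).trans hfv⟩

theorem IsMeanValue.iterate_mul_left (hμ : IsInvariantMean X μ) {u : S → H} {v : H}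
    (hv : IsMeanValue X μ u v) (s : S) (k : ℕ) :
    IsMeanValue X μ (fun t => u ((s * ·)^[k] t)) v := by
  induction k with
  | zero => exact hv
  | succ k ih => exact ih.mul_left hμ s

theorem IsMeanValue.sum {ι : Type*} (I : Finset ι) {u : ι → S → H} {v : ι → H}
    (hv : ∀ i, IsMeanValue X μ (u i) (v i)) :
    IsMeanValue X μ (fun t => ∑ i ∈ I, u i t) (∑ i ∈ I, v i) := fun y => by
  choose f hf hfv using fun i => hv i y
  refine ⟨∑ i ∈ I, f i, fun s => ?_, ?_⟩
  · rw [inner_sum, Submodule.coe_sum, BoundedContinuousFunction.sum_apply]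
    exact Finset.sum_congr rfl fun i _ => hf i s
  · rw [inner_sum, map_sum]
    exact Finset.sum_congr rfl fun i _ => hfv i

theorem IsMeanValue.inner_le (hμ : IsInvariantMean X μ) {u : S → H} {v : H}
    (hv : IsMeanValue X μ u v) {y : H} {c : ℝ} (h : ∀ s, inner ℝ y (u s) ≤ c) :
    inner ℝ y v ≤ c := by
  obtain ⟨f, hf, hfv⟩ := hv y
  change (inner ℂ y v).re ≤ c
  rw [← hfv]
  exact hμ.re_le fun s => by rw [hf]; exact h s

end MeanValue

/-! ### Attractive points -/

section Attractive

/-- The quadratic terms in `a` cancel, leaving an affine inequality: this gives convexity of the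
attractive set and lets the condition be tested by means. -/
theorem norm_sub_le_norm_sub_iff {F : Type*} [NormedAddCommGroup F] [InnerProductSpace ℝ F]
    (a p q : F) : ‖a - p‖ ≤ ‖a - q‖ ↔ 2 * inner ℝ (q - p) a + (‖p‖ ^ 2 - ‖q‖ ^ 2) ≤ 0 := by
  rw [← sq_le_sq₀ (norm_nonneg _) (norm_nonneg _), norm_sub_sq_real a p, norm_sub_sq_real a q,
    inner_sub_left, real_inner_comm a p, real_inner_comm a q]
  constructor <;> intro h <;> linarith

variable {S H : Type*} [NormedAddCommGroup H] {C : Set H} {T : S → C → C}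

theorem isClosed_attractivePoints : IsClosed (attractivePoints T) := by
  simp only [attractivePoints, ofPred_forall]
  exact isClosed_iInter fun s => isClosed_iInter fun x =>
    isClosed_le (by fun_prop) (by fun_prop)

/-- Each orbit stays in a ball around `a`, so a single bounded orbit, through its attractive mean
value, makes all orbits bounded. -/
theorem isBounded_orbit_of_mem {a : H} (ha : a ∈ attractivePoints T) (x : C) :
    Bornology.IsBounded (orbit T x) := by
  refine isBounded_iff_forall_norm_le.2 ⟨‖a‖ + ‖a - x‖, ?_⟩
  rintro _ ⟨s, rfl⟩
  have h1 := ha s x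
  have h2 := norm_sub_norm_le (T s x : H) a
  rw [norm_sub_rev] at h2
  linarith

theorem convex_attractivePoints [InnerProductSpace ℂ H] : Convex ℝ (attractivePoints T) := by
  intro a ha b hb r t hr ht hrt s x
  have h1 := (norm_sub_le_norm_sub_iff a _ _).1 (ha s x)
  have h2 := (norm_sub_le_norm_sub_iff b _ _).1 (hb s x)
  rw [norm_sub_le_norm_sub_iff, inner_add_right, inner_smul_right, inner_smul_right]
  have h3 := mul_nonpos_of_nonneg_of_nonpos hr h1
  have h4 := mul_nonpos_of_nonneg_of_nonpos ht h2
  have e : t = 1 - r := by linarith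
  subst e
  linarith

/-- The image under `T s` of the point of `C` nearest to `a` is no farther from `a`, so uniqueness
of the nearest point fixes it. -/
theorem exists_fixedPoint_of_attractivePoint [InnerProductSpace ℂ H] [CompleteSpace H]
    (hCne : C.Nonempty) (hC : IsClosed C) (hconv : Convex ℝ C) {a : H}
    (ha : a ∈ attractivePoints T) : ∃ x : C, ∀ s : S, T s x = x := by
  obtain ⟨p, hp⟩ := exists_isNearestPoint hCne hC hconv a
  refine ⟨⟨p, hp.1⟩, fun s => Subtype.ext ?_⟩
  have h1 := hp.sq_add_sq_le hconv (T s ⟨p, hp.1⟩).2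
  have h2 := pow_le_pow_left₀ (norm_nonneg _) (ha s ⟨p, hp.1⟩) 2
  have h3 : ‖p - (T s ⟨p, hp.1⟩ : H)‖ ^ 2 ≤ 0 := by linarith
  exact (sub_eq_zero.1 (norm_eq_zero.1 (pow_eq_zero_iff two_ne_zero |>.1
    (le_antisymm h3 (sq_nonneg _))))).symm

variable [Semigroup S]

/-- The inequality holds on the left ideal `St` since `a` is attractive, and passes to its closure
by continuity of the orbit map. -/
theorem norm_sub_le_of_le [TopologicalSpace S] (hT : IsRepresentation T) {x : C}
    (hcont : Continuous fun s : S => T s x) {a : H} (ha : a ∈ attractivePoints T) {t t' : S}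
    (h : (leftIdealPreorder S).le t t') : ‖(T t' x : H) - a‖ ≤ ‖(T t x : H) - a‖ := by
  rcases h (mem_insert _ _) with rfl | h
  · rfl
  · have hcl : IsClosed {s : S | ‖(T s x : H) - a‖ ≤ ‖(T t x : H) - a‖} :=
      isClosed_le (((continuous_subtype_val.comp hcont).sub continuous_const).norm)
        continuous_const
    refine closure_minimal ?_ hcl h
    rintro _ ⟨s, rfl⟩
    change ‖(T (s * t) x : H) - a‖ ≤ ‖(T t x : H) - a‖
    rw [hT s t x, norm_sub_rev, norm_sub_rev (T t x : H)]
    exact ha s (T t x)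

theorem IsGeneralizedHybrid.norm_meanValue_sub_le [InnerProductSpace ℂ H] [TopologicalSpace S]
    [SeparatelyContinuousMul S] {X : InvariantSubspace S} {μ : X.toSubmodule →L[ℂ] ℂ}
    (hμ : IsInvariantMean X μ) (hT : IsRepresentation T) {x : C}
    (hb : Bornology.IsBounded (orbit T x)) {v : H}
    (hv : IsMeanValue X μ (fun s => (T s x : H)) v) {s : S} (hs : IsGeneralizedHybrid (T s))
    (z : C) : ‖v - T s z‖ ≤ ‖v - z‖ := by
  obtain ⟨α, β, h⟩ := hs
  obtain ⟨R, hR⟩ := hb.exists_norm_le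
  set z' : H := (T s z : H) with hz'
  set A : S → ℝ := fun t => α * ‖(T t x : H) - z'‖ ^ 2 - β * ‖(T t x : H) - z‖ ^ 2 with hA
  set M := |α| * (R + ‖z'‖) ^ 2 + |β| * (R + ‖(z : H)‖) ^ 2 with hM
  have hAM : ∀ t, |A t| ≤ M := fun t => by
    have hn : ∀ w : H, ‖(T t x : H) - w‖ ^ 2 ≤ (R + ‖w‖) ^ 2 := fun w =>
      pow_le_pow_left₀ (norm_nonneg _)
        ((norm_sub_le _ _).trans (add_le_add_left (hR _ ⟨t, rfl⟩) _)) 2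
    refine (abs_sub _ _).trans ?_
    rw [abs_mul, abs_mul, abs_of_nonneg (sq_nonneg ‖(T t x : H) - z'‖),
      abs_of_nonneg (sq_nonneg ‖(T t x : H) - z‖)]
    exact add_le_add (mul_le_mul_of_nonneg_left (hn _) (abs_nonneg _))
      (mul_le_mul_of_nonneg_left (hn _) (abs_nonneg _))
  set δ := ‖z'‖ ^ 2 - ‖(z : H)‖ ^ 2 with hδ
  -- This is the hybrid inequality at `T t x` and `z`, with the `α` and `β` terms collected into
  -- `A`.
  have hstep : ∀ t, 2 * inner ℝ ((z : H) - z') (T t x : H) + δ ≤ A t - A (s * t) := fun t => by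
    have h1 := h (T t x) z
    rw [← hT s t x] at h1
    have h2 := norm_sub_sq_real (T t x : H) z'
    have h3 := norm_sub_sq_real (T t x : H) z
    rw [inner_sub_left, real_inner_comm (T t x : H) z, real_inner_comm (T t x : H) z']
    simp only [hA]
    linarith
  rw [norm_sub_le_norm_sub_iff]
  -- The telescoped right side is at most `2 * M` pointwise, and by left invariance each of the `n`
  -- shifted orbits has the same mean value `v`.
  have hn : ∀ n : ℕ, n * (2 * inner ℝ ((z : H) - z') v + δ) ≤ 2 * M := fun n => by
    have hsum := IsMeanValue.sum (Finset.range n) fun k => hv.iterate_mul_left hμ s k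
    have hle := hsum.inner_le hμ (y := (z : H) - z') (c := (2 * M - n * δ) / 2) fun t => by
      have h1 : ∑ k ∈ Finset.range n,
          (2 * inner ℝ ((z : H) - z') (T ((s * ·)^[k] t) x : H) + δ) ≤
            A t - A ((s * ·)^[n] t) := by
        have := Finset.sum_le_sum fun k (_ : k ∈ Finset.range n) => hstep ((s * ·)^[k] t)
        refine this.trans_eq ?_
        have e : ∀ k, s * (s * ·)^[k] t = (s * ·)^[k + 1] t := fun k =>
          (Function.iterate_succ_apply' _ _ _).symm
        simp only [e]
        exact Finset.sum_range_sub' (fun k => A ((s * ·)^[k] t)) n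
      rw [Finset.sum_add_distrib, ← Finset.mul_sum, Finset.sum_const, Finset.card_range,
        nsmul_eq_mul] at h1
      rw [inner_sum]
      have h2 := abs_le.1 (hAM t)
      have h3 := abs_le.1 (hAM ((s * ·)^[n] t))
      linarith
    rw [Finset.sum_const, Finset.card_range, ← Nat.cast_smul_eq_nsmul ℝ, inner_smul_right] at hle
    linarith
  by_contra! hpos
  obtain ⟨n, hn'⟩ := exists_nat_gt (2 * M / (2 * inner ℝ ((z : H) - z') v + δ))
  rw [div_lt_iff₀ hpos] at hn'
  exact absurd (hn n) (not_le.2 hn')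

theorem meanValue_mem_attractivePoints [InnerProductSpace ℂ H] [TopologicalSpace S]
    [SeparatelyContinuousMul S] {X : InvariantSubspace S} {μ : X.toSubmodule →L[ℂ] ℂ}
    (hμ : IsInvariantMean X μ) (hT : IsRepresentation T) {Λ : Set S}
    (hΛ : Subsemigroup.closure Λ = ⊤) (hhyb : ∀ s ∈ Λ, IsGeneralizedHybrid (T s)) {x : C}
    (hb : Bornology.IsBounded (orbit T x)) {v : H}
    (hv : IsMeanValue X μ (fun s => (T s x : H)) v) : v ∈ attractivePoints T := by
  intro s
  have hs : s ∈ Subsemigroup.closure Λ := hΛ ▸ Subsemigroup.mem_top s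
  induction hs using Subsemigroup.closure_induction with
  | mem s hs => exact (hhyb s hs).norm_meanValue_sub_le hμ hT hb hv
  | mul s t _ _ ihs iht =>
    intro z
    rw [hT s t z]
    exact (ihs _).trans (iht z)

theorem tendsto_metricProj_meanValue [InnerProductSpace ℂ H] [CompleteSpace H] [TopologicalSpace S]
    [SeparatelyContinuousMul S] {X : InvariantSubspace S} {μ : X.toSubmodule →L[ℂ] ℂ}
    (hS : RightReversible S) (hμ : IsInvariantMean X μ) (hT : IsRepresentation T) {x : C}
    (hcont : Continuous fun s : S => T s x) {v : H}
    (hv : IsMeanValue X μ (fun s => (T s x : H)) v) (hvA : v ∈ attractivePoints T) :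
    Tendsto (fun t : S => metricProj (attractivePoints T) (T t x)) (tails S) (𝓝 v) := by
  let _ := leftIdealPreorder S
  have := hS.isDirectedOrder
  have := hμ.nonempty
  obtain ⟨q, hqA, hq, hle⟩ := exists_tendsto_metricProj ⟨v, hvA⟩ isClosed_attractivePoints
    convex_attractivePoints (fun t : S => (T t x : H))
    fun a ha t t' htt' => norm_sub_le_of_le hT hcont ha htt'
  have hqv : inner ℝ (v - q) (v - q) ≤ 0 := by
    refine le_of_forall_pos_le_add fun ε hε => ?_
    obtain ⟨t₀, ht₀⟩ := hle v hvA ε hε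
    -- Every `s * t₀` lies beyond `t₀`, so the tail estimate holds for the whole right-shifted
    -- orbit, whose mean value is still `v`.
    have := (hv.mul_right hμ t₀).inner_le hμ (y := v - q) (c := ε + inner ℝ (v - q) q) fun s => by
      have h := ht₀ (s * t₀) (leftIdealPreorder_le_mul s t₀)
      rw [real_inner_comm, inner_sub_right] at h
      linarith
    rw [inner_sub_right]
    linarith
  rw [real_inner_self_nonpos, sub_eq_zero] at hqv
  exact hqv ▸ hq

end Attractive

end HybridErgodic

open HybridErgodic
theorem mainTheorem7 {S H : Type*} [Semigroup S] [TopologicalSpace S] [T2Space S]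
    [SeparatelyContinuousMul S] [NormedAddCommGroup H] [InnerProductSpace ℂ H] [CompleteSpace H]
    (hS : RightReversible S)
    (C : Set H) (hCne : C.Nonempty) (hC : IsClosed C)
    (T : S → C → C) (hT : IsRepresentation T)
    (hcont : ∀ x : C, Continuous fun s : S => T s x)
    (Λ : Set S) (hΛ : Subsemigroup.closure Λ = ⊤) (hhyb : ∀ s ∈ Λ, IsGeneralizedHybrid (T s))
    (hbdd : ∃ c : C, Bornology.IsBounded (orbit T c))
    (X : InvariantSubspace S) (hX : AdmissibleCase T X)
    (μ : X.toSubmodule →L[ℂ] ℂ) (hμ : IsInvariantMean X μ) :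
    ((attractivePoints T).Nonempty ∧ IsClosed (attractivePoints T) ∧
      Convex ℝ (attractivePoints T)) ∧
    (∀ x : C, ∃ v : H, IsMeanValue X μ (fun s => (T s x : H)) v ∧ v ∈ attractivePoints T ∧
      Tendsto (fun t : S => metricProj (attractivePoints T) (T t x)) (tails S) (𝓝 v)) ∧
    (Convex ℝ C → ∃ x : C, ∀ s : S, T s x = x) := by
  have hmean : ∀ x : C, Bornology.IsBounded (orbit T x) →
      ∃ v : H, IsMeanValue X μ (fun s => (T s x : H)) v ∧ v ∈ attractivePoints T := fun x hb => by
    obtain ⟨v, hv⟩ := exists_isMeanValue μ (hcont x) hb (hX.coefficient_mem hT (hcont x) hb)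
    exact ⟨v, hv, meanValue_mem_attractivePoints hμ hT hΛ hhyb hb hv⟩
  obtain ⟨c, hc⟩ := hbdd
  obtain ⟨a, -, ha⟩ := hmean c hc
  refine ⟨⟨⟨a, ha⟩, isClosed_attractivePoints, convex_attractivePoints⟩, fun x => ?_, fun hconv =>
    exists_fixedPoint_of_attractivePoint hCne hC hconv ha⟩
  obtain ⟨v, hv, hvA⟩ := hmean x (isBounded_orbit_of_mem ha x)
  exact ⟨v, hv, hvA, tendsto_metricProj_meanValue hS hμ hT (hcont x) hv hvA⟩
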